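/- All graphs are finite. For a metric $\mu$ on a finite set $V$ let $I(x,y)=\{z:\mu(x,z)+\mu(z,y)=\mu(x,y)\}$; $\mu$ is modular if $I(x,y)\cap I(y,z)\cap I(x,z)\neq\varnothing$ for all $x,y,z\in V$. Let $H_\mu$ be the undirected weighted graph on $V$ in which distinct $x,y$ are joined by an edge, of weight $\mu(x,y)$, iff $\mu(x,y)<\mu(x,z)+\mu(z,y)$ for all $z\in V\setminus\{x,y\}$. A modular complex (oriented modular graph) is a weighted directed graph $\Gamma=(V,E,w)$ obtained from $H_\mu$, for some modular metric $\mu$, by giving each edge exactly one direction so that in every 4-cycle $x_1,x_2,x_3,x_4$ the condition $x_1\to x_2$ implies $x_4\to x_3$. Write $p\preceq q$ if there is a directed path from $p$ to $q$ in $\Gamma$, and $[p,q]=\{x: p\preceq x\preceq q\}$; joins $\vee$ and meets $\wedge$ are taken with respect to $\preceq$. An extended modular complex is a modular complex $\Gamma$ with a binary relation $\sqsubseteq$ on $V$ such that $p\sqsubseteq q$ implies $p\preceq q$; $p\sqsubseteq p$ for all $p$; $p\sqsubseteq q$ for every edge $p\to q$; and (a) if $p\sqsubseteq q$, $a\preceq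 b$ and $a,b\in[p,q]$, then $a\sqsubseteq b$; (b) if $p\sqsubseteq q_1$, $p\sqsubseteq q_2$ and $q_1\vee q_2$ exists, then $p\sqsubseteq q_1\vee q_2$; (c) if $p_1\sqsubseteq q$, $p_2\sqsubseteq q$ and $p_1\wedge p_2$ exists, then $p_1\wedge p_2\sqsubseteq q$. The 2-subdivision of $(\Gamma,\sqsubseteq)$ is the weighted directed graph $\Gamma^*=(V^*,E^*,w^*)$ with vertex set $V^*=\{[p,q]: p\sqsubseteq q\}$, with an edge $[p,q]\to[p,q']$ of weight $w(qq')$ for all $[p,q],[p,q']\in V^*$ with $q\to q'$ in $\Gamma$, and an edge $[p,q]\to[p',q]$ of weight $w(p'p)$ for all $[p,q],[p',q]\in V^*$ with $p'\to p$ in $\Gamma$. **Theorem.** If $(\Gamma,\sqsubseteq)$ is an extended modular complex, then distinct pairs $p\sqsubseteq q$ give distinct intervals $[p,q]$ (so that $\Gamma^*$ is well defined), and $\Gamma^*=(V^*,E^*,w^*)$ is a modular complex, that is, an oriented modular graph. -/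

import Mathlib

/-- The metric interval `I(x, y) = {z | μ(x,z) + μ(z,y) = μ(x,y)}` of a metric space. -/
def metricInterval {V : Type*} [MetricSpace V] (x y : V) : Set V :=
  {z | dist x z + dist z y = dist x y}

/-- A metric is modular if every triple of points has a median. -/
def IsModularMetric (V : Type*) [MetricSpace V] : Prop :=
  ∀ x y z : V, (metricInterval x y ∩ metricInterval y z ∩ metricInterval x z).Nonempty

/-- The edge set of `H_μ`, the minimal graph whose path metric (for the edge lengths `μ`)
is the given metric `μ`. -/
def metricGraph (V : Type*) [MetricSpace V] : SimpleGraph V where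
  Adj x y := x ≠ y ∧ ∀ z, z ≠ x → z ≠ y → dist x y < dist x z + dist z y
  symm := ⟨fun x y h => ⟨h.1.symm, fun z hx hy => by
    have := h.2 z hy hx
    rw [dist_comm y x, dist_comm y z, dist_comm z x]
    linarith⟩⟩
  loopless := ⟨fun _ h => h.1 rfl⟩

/-- A directed graph with a real weight on every edge. The values of `wt` on pairs that are
not edges carry no information. -/
structure WeightedDigraph (V : Type*) extends Digraph V where
  /-- The weight of the edge from the first vertex to the second. -/
  wt : V → V → ℝ

namespace WeightedDigraph

variable {V : Type*} (Γ : WeightedDigraph V)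

/-- The underlying undirected graph of `Γ`. -/
def underlying : SimpleGraph V := Γ.toDigraph.toSimpleGraphInclusive

/-- The underlying undirected weighted graph is modular: it is `H_μ`, edge weights included,
for some modular metric `μ` on the vertex set. -/
def IsModular : Prop :=
  ∃ _ : MetricSpace V, IsModularMetric V ∧ Γ.underlying = metricGraph V ∧
    ∀ u v, Γ.Adj u v → Γ.wt u v = dist u v

/-- The orientation is admissible: in every 4-cycle `x₁ x₂ x₃ x₄` of the underlying graph,
`x₁ → x₂` implies `x₄ → x₃`. (Consecutive vertices are distinct by adjacency.) -/
def IsAdmissibleOrientation : Prop :=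
  ∀ x₁ x₂ x₃ x₄ : V, x₁ ≠ x₃ → x₂ ≠ x₄ →
    Γ.underlying.Adj x₁ x₂ → Γ.underlying.Adj x₂ x₃ →
    Γ.underlying.Adj x₃ x₄ → Γ.underlying.Adj x₄ x₁ →
    Γ.Adj x₁ x₂ → Γ.Adj x₄ x₃

/-- A modular complex (oriented modular graph): a finite modular weighted graph together with
an admissible orientation of its edges. -/
structure IsModularComplex : Prop where
  finite : Finite V
  /-- `Γ` is an orientation of a simple graph: no loops, and each edge has one direction. -/
  asymm : ∀ u v, Γ.Adj u v → ¬ Γ.Adj v u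
  modular : Γ.IsModular
  admissible : Γ.IsAdmissibleOrientation

/-- The relation `p ⪯ q`: there is a directed path from `p` to `q`. -/
def Le (p q : V) : Prop := Relation.ReflTransGen Γ.Adj p q

/-- The interval `[p, q] = {x | p ⪯ x ⪯ q}`. -/
def interval (p q : V) : Set V := {x | Γ.Le p x ∧ Γ.Le x q}

/-- `c` is the join `a ∨ b`, the least common upper bound with respect to `⪯`. -/
def IsJoin (a b c : V) : Prop :=
  Γ.Le a c ∧ Γ.Le b c ∧ ∀ d, Γ.Le a d → Γ.Le b d → Γ.Le c d

/-- `c` is the meet `a ∧ b`, the greatest common lower bound with respect to `⪯`. -/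
def IsMeet (a b c : V) : Prop :=
  Γ.Le c a ∧ Γ.Le c b ∧ ∀ d, Γ.Le d a → Γ.Le d b → Γ.Le d c

/-- Admissible relations `R` (written `⊑`) on the vertices of a modular complex. -/
structure IsAdmissibleRel (R : V → V → Prop) : Prop where
  le : ∀ p q, R p q → Γ.Le p q
  refl : ∀ p, R p p
  edge : ∀ p q, Γ.Adj p q → R p q
  sub : ∀ p q a b, R p q → Γ.Le a b → a ∈ Γ.interval p q → b ∈ Γ.interval p q → R a b
  join : ∀ p q₁ q₂ j, R p q₁ → R p q₂ → Γ.IsJoin q₁ q₂ j → R p j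
  meet : ∀ p₁ p₂ q m, R p₁ q → R p₂ q → Γ.IsMeet p₁ p₂ m → R m q

/-- An extended modular complex: a modular complex with an admissible relation. -/
structure IsExtendedModularComplex (R : V → V → Prop) : Prop where
  complex : Γ.IsModularComplex
  rel : Γ.IsAdmissibleRel R

/-- The vertices of the 2-subdivision: the intervals `[p, q]` with `p ⊑ q`, each recorded by
the pair `(p, q)` of its endpoints. -/
abbrev SubdivisionVertex (R : V → V → Prop) : Type _ := {I : V × V // R I.1 I.2}

/-- The 2-subdivision `Γ*`: edges `[p, q] → [p, q']` for `q → q'` with weight `w(qq')`,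
and edges `[p, q] → [p', q]` for `p' → p` with weight `w(p'p)`. -/
noncomputable def twoSubdivision (R : V → V → Prop) :
    WeightedDigraph (SubdivisionVertex R) where
  Adj I J :=
    (I.1.1 = J.1.1 ∧ Γ.Adj I.1.2 J.1.2) ∨ (I.1.2 = J.1.2 ∧ Γ.Adj J.1.1 I.1.1)
  wt I J := open Classical in
    if I.1.1 = J.1.1 then Γ.wt I.1.2 J.1.2 else Γ.wt J.1.1 I.1.1

end WeightedDigraph

/-! Give the pairs `p ⊑ q` the metric `μ(p,p') + μ(q,q')`. The point is that this metric is modular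
and that its graph is the underlying graph of `Γ*`.

In `Γ`, directed paths are geodesics, the metric interval of a comparable pair is its order
interval, principal filters and ideals are convex, and a common upper bound on a geodesic between
two elements is their join. Hence (b) and (c) make `{x | p ⊑ x}` and `{x | x ⊑ q}` convex
(`upper_convex`, `lower_convex`).

Modularity of a finite metric is local: it follows from a parity condition on edges and the
quadrangle condition. Two moves of the same endpoint are handled by convexity. The hard case is
`rel_of_adj_of_adj`: a move of the lower end and a move of the upper end, both towards a related
pair `(s,t)`, must be compatible. There `s` and `t` are projected to their gates in an order
interval; `exists_step` moves a related pair towards the gates one endpoint at a time, so the gates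
are related (`rel_of_gates`). The same step shows that edges of the sum metric change only one
endpoint. -/

/-! ### Betweenness in metric spaces -/

/-- The point `z` lies on a geodesic from `x` to `y`. -/
def Between {V : Type*} [MetricSpace V] (x z y : V) : Prop :=
  dist x z + dist z y = dist x y

namespace Between

variable {V : Type*} [MetricSpace V] {x y z u : V}

theorem symm (h : Between x z y) : Between y z x := by
  unfold Between at *
  rw [dist_comm y z, dist_comm z x, dist_comm y x]
  linarith

theorem left (x y : V) : Between x x y := by simp [Between]

theorem right (x y : V) : Between x y y := by simp [Between]

theorem shrink_left (h₁ : Between x u z) (h₂ : Between x z y) : Between u z y := by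
  unfold Between at *
  linarith [dist_triangle x u y, dist_triangle u z y]

theorem extend_right (h₁ : Between x u z) (h₂ : Between x z y) : Between x u y := by
  unfold Between at *
  linarith [dist_triangle x u y, dist_triangle u z y]

theorem shrink_right (h₁ : Between z u y) (h₂ : Between x z y) : Between x z u :=
  (h₁.symm.shrink_left h₂.symm).symm

theorem extend_left (h₁ : Between z u y) (h₂ : Between x z y) : Between x u y :=
  (h₁.symm.extend_right h₂.symm).symm

theorem antisymm (h₁ : Between x y z) (h₂ : Between x z y) : y = z := by
  unfold Between at *
  refine dist_le_zero.1 ?_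
  linarith [dist_comm y z, dist_nonneg (x := y) (y := z)]

theorem eq_of_self (h : Between x z x) : z = x := by
  unfold Between at h
  refine dist_le_zero.1 ?_
  rw [dist_self] at h
  linarith [dist_comm x z]

theorem dist_lt_right (h : Between x z y) (hne : z ≠ x) : dist z y < dist x y := by
  unfold Between at h
  linarith [dist_pos.2 hne.symm]

end Between

theorem IsModularMetric.exists_median {V : Type*} [MetricSpace V] (h : IsModularMetric V)
    (x y z : V) : ∃ m, Between x m y ∧ Between y m z ∧ Between x m z := by
  obtain ⟨m, ⟨h₁, h₂⟩, h₃⟩ := h x y z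
  exact ⟨m, h₁, h₂, h₃⟩

/-- Induction along a real-valued function on a finite type. -/
theorem Finite.induction_of_real {W : Type*} [Finite W] (f : W → ℝ) {P : W → Prop}
    (h : ∀ x, (∀ y, f y < f x → P y) → P x) (x : W) : P x := by
  have : IsTrans W (fun a b => f a < f b) := ⟨fun a b c hab hbc => lt_trans hab hbc⟩
  have : Std.Irrefl (fun a b : W => f a < f b) := ⟨fun a => lt_irrefl _⟩
  exact (Finite.wellFounded_of_trans_of_irrefl (fun a b : W => f a < f b)).induction x h

/-! ### Modularity from local conditions -/

section metricGraph

variable {V : Type*} [MetricSpace V] {x y z : V}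

theorem metricGraph_adj_iff :
    (metricGraph V).Adj x y ↔ x ≠ y ∧ ∀ z, Between x z y → z = x ∨ z = y := by
  constructor
  · rintro ⟨hne, h⟩
    refine ⟨hne, fun z hz => ?_⟩
    by_contra! hc
    exact (h z hc.1 hc.2).ne (Eq.symm hz)
  · rintro ⟨hne, h⟩
    refine ⟨hne, fun z hx hy => lt_of_le_of_ne (dist_triangle x z y) fun he => ?_⟩
    rcases h z he.symm with h | h
    · exact hx h
    · exact hy h

theorem eq_or_eq_of_adj (h : (metricGraph V).Adj x y) (hz : Between x z y) : z = x ∨ z = y :=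
  (metricGraph_adj_iff.1 h).2 z hz

theorem exists_adj_between [Finite V] (hne : x ≠ z) :
    ∃ u, (metricGraph V).Adj x u ∧ Between x u z := by
  obtain ⟨u, ⟨hux, hu⟩, hmin⟩ := Set.exists_min_image {u | u ≠ x ∧ Between x u z}
    (fun u => dist x u) (Set.toFinite _) ⟨z, hne.symm, Between.right x z⟩
  refine ⟨u, metricGraph_adj_iff.2 ⟨hux.symm, fun v hv => ?_⟩, hu⟩
  by_contra! hc
  have h := hmin v ⟨hc.1, hv.extend_right hu⟩
  have hv' : dist x v + dist v u = dist x u := hv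
  linarith [dist_pos.2 hc.2]

/-- The local conditions (no odd triangles, and the quadrangle condition) imply modularity. -/
theorem isModularMetric_of_quadrangle [Finite V]
    (hbip : ∀ x y z : V, (metricGraph V).Adj x y → Between z x y ∨ Between z y x)
    (hquad : ∀ x y₁ y₂ z : V, (metricGraph V).Adj x y₁ → (metricGraph V).Adj x y₂ → y₁ ≠ y₂ →
      Between x y₁ z → Between x y₂ z → ∃ m, Between y₁ m y₂ ∧ Between y₁ m z ∧ Between y₂ m z) :
    IsModularMetric V := by
  suffices H : ∀ (w : V) (a : V × V), ∃ m, Between a.1 m a.2 ∧ Between a.2 m w ∧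
      Between a.1 m w by
    intro x y z
    obtain ⟨m, h₁, h₂, h₃⟩ := H z (x, y)
    exact ⟨m, ⟨h₁, h₂⟩, h₃⟩
  intro w a
  induction a using Finite.induction_of_real (fun a : V × V => dist a.1 a.2) with
  | h a ih =>
  obtain ⟨u, v⟩ := a
  simp only at ih ⊢
  by_cases huv : v = u
  · subst huv
    exact ⟨v, Between.left _ _, Between.left _ _, Between.left _ _⟩
  obtain ⟨x, hvx, hx⟩ := exists_adj_between huv
  obtain ⟨m, hm₁, hm₂, hm₃⟩ := ih (u, x) (by
    have := hx.dist_lt_right hvx.1.symm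
    simpa only [dist_comm u] using this)
  simp only at hm₁ hm₂ hm₃
  rcases hbip v x w hvx with hB | hA
  · by_cases hmx : m = x
    · subst hmx
      exact ⟨v, Between.right _ _, Between.left _ _, hB.symm.extend_left hm₃⟩
    -- Both `v` and `y` are nearer to `w` than `x` is. The quadrangle point `n` is nearer to `u`
    -- than `v` is, and a median of `u, n, w` also serves for `u, v, w`.
    obtain ⟨y, hxy, hy⟩ := exists_adj_between (Ne.symm hmx)
    have hyw : Between x y w := hy.extend_right hm₂
    have hyu : Between x y u := hy.extend_right hm₁.symm
    have hvxy : Between v x y := hyu.shrink_right hx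
    have hvy : v ≠ y := by
      rintro rfl
      exact hvx.1 hvxy.eq_of_self.symm
    obtain ⟨n, hn₁, hn₂, hn₃⟩ := hquad x v y w hvx.symm hxy hvy hB.symm hyw
    have hnv : n ≠ v := by
      rintro rfl
      have : Between x y n := hn₃.shrink_right hyw
      rcases eq_or_eq_of_adj hvx.symm this with h | h
      · exact hxy.1 h.symm
      · exact hvy h.symm
    have hvyu : Between v y u := hyu.extend_left hx
    have hnu : Between v n u := hn₁.extend_right hvyu
    obtain ⟨k, hk₁, hk₂, hk₃⟩ := ih (u, n) (by
      have := hnu.dist_lt_right hnv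
      simpa only [dist_comm u] using this)
    simp only at hk₁ hk₂ hk₃
    exact ⟨k, hk₁.extend_right hnu.symm, hk₂.extend_left hn₂, hk₃⟩
  · exact ⟨m, hm₁.extend_right hx.symm, hm₂.extend_left hA.symm, hm₃⟩

end metricGraph

/-! ### Edges and rectangles in modular metrics -/

namespace IsModularMetric

variable {V : Type*} [MetricSpace V] {x y z : V}

theorem between_or_between (hV : IsModularMetric V) (h : (metricGraph V).Adj x y) (z : V) :
    Between z x y ∨ Between z y x := by
  obtain ⟨m, h₁, h₂, h₃⟩ := hV.exists_median x y z
  rcases eq_or_eq_of_adj h h₁ with rfl | rfl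
  · exact Or.inl h₂.symm
  · exact Or.inr h₃.symm

/-- The side opposite to an edge in a metric rectangle is an edge. -/
theorem adj_of_rectangle (hV : IsModularMetric V) {s t g h : V} (hst : (metricGraph V).Adj s t)
    (hsg : Between s g h) (hth : Between t h g) (h₁ : dist s g = dist t h)
    (h₂ : dist s t = dist g h) : (metricGraph V).Adj g h := by
  have hgh : g ≠ h := by
    rintro rfl
    rw [dist_self] at h₂
    exact hst.1 (dist_le_zero.1 h₂.le)
  refine metricGraph_adj_iff.2 ⟨hgh, fun u hu => ?_⟩
  have hsu : dist s g + dist g u = dist s u := hu.shrink_right hsg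
  have htu : dist t h + dist h u = dist t u := hu.symm.shrink_right hth
  rcases hV.between_or_between hst u with hb | hb
  · left
    unfold Between at hb hu
    have : dist g u ≤ 0 := by
      linarith [dist_comm u s, dist_comm u t, dist_comm h u]
    exact (dist_le_zero.1 this).symm
  · right
    unfold Between at hb hu
    have : dist h u ≤ 0 := by
      linarith [dist_comm u s, dist_comm u t, dist_comm h u, dist_comm s t]
    exact (dist_le_zero.1 this).symm

theorem between_of_adj_of_adj (hV : IsModularMetric V) {y₁ y₂ : V}
    (h₁ : (metricGraph V).Adj x y₁) (h₂ : (metricGraph V).Adj x y₂) (hne : y₁ ≠ y₂) :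
    Between y₁ x y₂ := by
  rcases hV.between_or_between h₁ y₂ with h | h
  · exact h.symm
  · rcases eq_or_eq_of_adj h₂ h.symm with h | h
    · exact absurd h.symm h₁.1
    · exact absurd h hne

/-- The median `m` of `y₁, y₂, z` is opposite to `x` in a metric rectangle, whose sides at `m` are
parallel to the two given edges. -/
theorem quadrangle (hV : IsModularMetric V) {y₁ y₂ : V}
    (h₁ : (metricGraph V).Adj x y₁) (h₂ : (metricGraph V).Adj x y₂) (hne : y₁ ≠ y₂)
    (hz₁ : Between x y₁ z) (hz₂ : Between x y₂ z) :
    ∃ m, (metricGraph V).Adj y₁ m ∧ (metricGraph V).Adj y₂ m ∧ Between y₁ m z ∧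
      Between y₂ m z ∧ Between y₁ m y₂ ∧ m ≠ x := by
  obtain ⟨m, hm₁₂, hm₂, hm₁⟩ := hV.exists_median y₁ y₂ z
  have hx₁₂ := hV.between_of_adj_of_adj h₁ h₂ hne
  have hxm₁ : Between x y₁ m := hm₁.shrink_right hz₁
  have hxm₂ : Between x y₂ m := hm₂.shrink_right hz₂
  have e₁ : dist x y₁ = dist y₂ m := by
    unfold Between at *
    linarith [dist_comm x y₁, dist_comm m y₂]
  have e₂ : dist x y₂ = dist y₁ m := by
    unfold Between at *
    linarith [dist_comm x y₁, dist_comm m y₂]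
  refine ⟨m, hV.adj_of_rectangle h₂ hxm₁ hm₁₂.symm e₁ e₂,
    hV.adj_of_rectangle h₁ hxm₂ hm₁₂ e₂ e₁, hm₁, hm₂, hm₁₂, ?_⟩
  rintro rfl
  exact h₁.1 hxm₁.eq_of_self.symm

end IsModularMetric

/-! ### Admissible orientations of modular metrics -/

/-- The relation `A` is an admissible orientation of the graph of a modular metric. -/
structure IsModularOrientation {V : Type*} [MetricSpace V] (A : V → V → Prop) : Prop where
  modular : IsModularMetric V
  asymm : ∀ u v, A u v → ¬ A v u
  adj_iff : ∀ u v, (metricGraph V).Adj u v ↔ A u v ∨ A v u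
  square : ∀ x₁ x₂ x₃ x₄, x₁ ≠ x₃ → x₂ ≠ x₄ → (metricGraph V).Adj x₁ x₂ →
    (metricGraph V).Adj x₂ x₃ → (metricGraph V).Adj x₃ x₄ → (metricGraph V).Adj x₄ x₁ →
    A x₁ x₂ → A x₄ x₃

namespace IsModularOrientation

open Relation

variable {V : Type*} [MetricSpace V] {A : V → V → Prop} {p q r x y z : V}

theorem swap (hA : IsModularOrientation A) : IsModularOrientation (Function.swap A) where
  modular := hA.modular
  asymm u v h := hA.asymm v u h
  adj_iff u v := (hA.adj_iff u v).trans or_comm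
  square x₁ x₂ x₃ x₄ h₁₃ h₂₄ h₁₂ h₂₃ h₃₄ h₄₁ h :=
    hA.square x₂ x₁ x₄ x₃ h₂₄ h₁₃ h₁₂.symm h₄₁.symm h₃₄.symm h₂₃.symm h

theorem adj (hA : IsModularOrientation A) (h : A x y) : (metricGraph V).Adj x y :=
  (hA.adj_iff x y).2 (Or.inl h)

/-- Induction along the path. Suppose the path ends in `y → y'` and `y' → z` leads back towards `p`.
The quadrangle condition gives a 4-cycle `y', z, m, y` with `m` nearer to `p` than `y`;
admissibility yields `y → m`, against the induction hypothesis at `y`. -/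
theorem between_of_le_of_rel (hA : IsModularOrientation A) (h : ReflTransGen A p y) :
    ∀ z, A y z → Between p y z := by
  induction h with
  | refl => exact fun z _ => Between.left _ _
  | @tail y y' _ hy ih =>
    intro z hz
    have hpy := ih y' hy
    rcases hA.modular.between_or_between (hA.adj hz) p with h | h
    · exact h
    exfalso
    have hyz : y ≠ z := by
      rintro rfl
      exact hA.asymm _ _ hy hz
    obtain ⟨m, hym, hzm, hyp, hzp, hmyz, hmx⟩ :=
      hA.modular.quadrangle (hA.adj hy).symm (hA.adj hz) hyz hpy.symm h.symm
    have := hA.square y' z m y hmx.symm hyz.symm (hA.adj hz) hzm hym.symm (hA.adj hy) hz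
    exact hym.1 (hyp.symm.antisymm (ih m this)).symm

theorem between_of_le_of_le (hA : IsModularOrientation A) (h₁ : ReflTransGen A p q)
    (h₂ : ReflTransGen A q r) : Between p q r := by
  induction h₂ with
  | refl => exact Between.right _ _
  | @tail r r' hr hr' ih =>
    have e₁ := hA.between_of_le_of_rel (h₁.trans hr) r' hr'
    exact ih.extend_right e₁

theorem le_antisymm (hA : IsModularOrientation A) (h₁ : ReflTransGen A p q)
    (h₂ : ReflTransGen A q p) : p = q :=
  (hA.between_of_le_of_le h₁ h₂).eq_of_self.symm

/-- With `q' → q` the last edge of the path, the quadrangle condition gives a 4-cycle `q', q, y, m`.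
By induction `p ⪯ m` and `m → q'`; admissibility copies the edges `q' → q` and `m → q'` to `m → y`
and `y → q`. -/
theorem le_and_rel_of_adj (hA : IsModularOrientation A) (h : ReflTransGen A p q) :
    ∀ y, (metricGraph V).Adj y q → Between p y q → ReflTransGen A p y ∧ A y q := by
  induction h with
  | refl => exact fun y hy h => absurd h.eq_of_self hy.1
  | @tail q' q hq' hq ih =>
    intro y hy hpy
    by_cases hyq : y = q'
    · subst hyq
      exact ⟨hq', hq⟩
    obtain ⟨m, hym, hqm, hyp, hqp, -, hmq⟩ := hA.modular.quadrangle hy.symm (hA.adj hq).symm hyq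
      hpy.symm (hA.between_of_le_of_rel hq' q hq).symm
    obtain ⟨h₁, h₂⟩ := ih m hqm.symm hqp.symm
    have h₃ := hA.square q' q y m (Ne.symm hyq) hmq.symm (hA.adj hq) hy.symm hym hqm.symm hq
    exact ⟨h₁.tail h₃, hA.square m q' q y hmq (Ne.symm hyq) hqm.symm (hA.adj hq) hy.symm hym h₂⟩

theorem le_and_le_of_between [Finite V] (hA : IsModularOrientation A)
    (h : ReflTransGen A p q) (hx : Between p x q) : ReflTransGen A p x ∧ ReflTransGen A x q := by
  induction q using Finite.induction_of_real (fun q => dist p q) with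
  | h q ih =>
  by_cases hxq : q = x
  · subst hxq
    exact ⟨h, .refl⟩
  obtain ⟨y, hqy, hy⟩ := exists_adj_between hxq
  have hpy : Between p y q := hy.symm.extend_left hx
  obtain ⟨h₁, h₂⟩ := hA.le_and_rel_of_adj h y hqy.symm hpy
  have hlt : dist p y < dist p q := by
    simpa only [dist_comm p] using hpy.symm.dist_lt_right hqy.1.symm
  obtain ⟨h₃, h₄⟩ := ih y hlt h₁ (hy.symm.shrink_right hx)
  exact ⟨h₃, h₄.tail h₂⟩

/-- Principal filters are convex. -/
theorem le_of_between_of_le [Finite V] (hA : IsModularOrientation A)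
    (hx : ReflTransGen A p x) (hy : ReflTransGen A p y) (hz : Between x z y) :
    ReflTransGen A p z := by
  suffices H : ∀ a : V × V, ReflTransGen A p a.1 → ReflTransGen A p a.2 →
      ∀ z, Between a.1 z a.2 → ReflTransGen A p z from H (x, y) hx hy z hz
  clear hx hy hz
  intro a
  induction a using Finite.induction_of_real (fun a : V × V => dist a.1 a.2) with
  | h a ih =>
  obtain ⟨x, y⟩ := a
  intro hx hy z hz
  simp only at hx hy hz ih
  by_cases hxz : x = z
  · exact hxz ▸ hx
  obtain ⟨u, hxu, hu⟩ := exists_adj_between hxz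
  have huy : Between x u y := hu.extend_right hz
  have hpu : ReflTransGen A p u := by
    rcases hA.modular.between_or_between hxu p with hb | hb
    · obtain ⟨m, hm₁, hm₂, hm₃⟩ := hA.modular.exists_median p u y
      by_cases hum : u = m
      · subst hum
        exact (hA.le_and_le_of_between hy hm₃).1
      -- `u'` is nearer than `u` to both `p` and `y`, and `s` completes a square below `x`. The
      -- shorter pair `(s, y)` gives `p ⪯ u'`, and `s → x` is copied to `u' → u`.
      obtain ⟨u', huu', hu'⟩ := exists_adj_between hum
      have hu'p : Between u u' p := hu'.extend_right hm₁.symm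
      have hu'y : Between u u' y := hu'.extend_right hm₂
      have hxuu' : Between x u u' := hu'y.shrink_right huy
      have hxu' : x ≠ u' := by
        rintro rfl
        exact hxu.1 hxuu'.eq_of_self.symm
      obtain ⟨s, hxs, hu's, hsp, -, hsu', hsu⟩ :=
        hA.modular.quadrangle hxu.symm huu' hxu' hb.symm hu'p
      obtain ⟨hps, hsx⟩ := hA.le_and_rel_of_adj hx s hxs.symm hsp.symm
      have hxu'y : Between x u' y := hu'y.extend_left huy
      have hsy : Between x s y := hsu'.extend_right hxu'y
      have hpu' := ih (s, y) (hsy.dist_lt_right hxs.1.symm) hps hy u' (hsu'.shrink_left hxu'y)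
      exact hpu'.tail (hA.square s x u u' hsu hxu' hxs.symm hxu huu' hu's hsx)
    · exact (hA.le_and_le_of_between hx hb).1
  exact ih (u, y) (huy.dist_lt_right hxu.1.symm) hpu hy z (hu.shrink_left hz)

/-- A common upper bound on a geodesic between two elements is their join. -/
theorem le_of_between_of_upper_bound [Finite V] (hA : IsModularOrientation A) {c d : V}
    (hx : ReflTransGen A x c) (hy : ReflTransGen A y c) (hc : Between x c y)
    (hxd : ReflTransGen A x d) (hyd : ReflTransGen A y d) : ReflTransGen A c d := by
  -- `m` is an upper bound below `d`, and `n` is an upper bound below `c`. Since `c` lies on a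
  -- geodesic from `x` to `y`, `n = c`; this puts `c` between `x` and `m`.
  obtain ⟨m, hm₁, hm₂, hm₃⟩ := hA.modular.exists_median x y d
  obtain ⟨hxm, hmd⟩ := hA.le_and_le_of_between hxd hm₃
  obtain ⟨hym, -⟩ := hA.le_and_le_of_between hyd hm₂
  obtain ⟨n, hn₁, hn₂, hn₃⟩ := hA.modular.exists_median c m x
  have hyn : ReflTransGen A y n := hA.le_of_between_of_le hy hym hn₁
  obtain ⟨hxn, hnc⟩ := hA.le_and_le_of_between hx hn₃.symm
  have h₁ : Between y n c := hA.between_of_le_of_le hyn hnc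
  have h₂ : Between n c y := hn₃.symm.shrink_left hc
  obtain rfl := h₁.antisymm h₂.symm
  exact (hA.le_and_le_of_between hxm hn₂.symm).2.trans hmd

/-- The gate is a nearest point `g` of `[p, q]` to `s`: the median of `s, g, y` stays in `[p, q]` by
convexity, hence equals `g`. -/
theorem exists_gate [Finite V] (hA : IsModularOrientation A) (h : ReflTransGen A p q) (s : V) :
    ∃ g, ReflTransGen A p g ∧ ReflTransGen A g q ∧
      ∀ y, ReflTransGen A p y → ReflTransGen A y q → Between s g y := by
  obtain ⟨g, ⟨hg₁, hg₂⟩, hmin⟩ :=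
    Set.exists_min_image {y | ReflTransGen A p y ∧ ReflTransGen A y q}
    (fun u => dist s u) (Set.toFinite _) ⟨p, .refl, h⟩
  refine ⟨g, hg₁, hg₂, fun y hy₁ hy₂ => ?_⟩
  obtain ⟨m, hm₁, hm₂, hm₃⟩ := hA.modular.exists_median s g y
  have hmp := hA.le_of_between_of_le hg₁ hy₁ hm₂
  have hmq := hA.swap.le_of_between_of_le (reflTransGen_swap.2 hg₂) (reflTransGen_swap.2 hy₂) hm₂
  have h₁ := hmin m ⟨hmp, reflTransGen_swap.1 hmq⟩
  have hmg : m = g := by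
    refine dist_le_zero.1 ?_
    unfold Between at hm₁
    linarith
  exact hmg ▸ hm₃

end IsModularOrientation

/-! ### Convexity of admissible relations and gates -/

/-- Admissible relations, with joins and meets described by betweenness. -/
structure IsConvexRelation {V : Type*} [MetricSpace V] (A R : V → V → Prop) : Prop where
  orientation : IsModularOrientation A
  le : ∀ p q, R p q → Relation.ReflTransGen A p q
  refl : ∀ p, R p p
  edge : ∀ p q, A p q → R p q
  sub : ∀ p q a b, R p q → Relation.ReflTransGen A p a → Relation.ReflTransGen A a b →
    Relation.ReflTransGen A b q → R a b
  join : ∀ p q₁ q₂ j, R p q₁ → R p q₂ → Relation.ReflTransGen A q₁ j →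
    Relation.ReflTransGen A q₂ j → Between q₁ j q₂ → R p j
  meet : ∀ p₁ p₂ q m, R p₁ q → R p₂ q → Relation.ReflTransGen A m p₁ →
    Relation.ReflTransGen A m p₂ → Between p₁ m p₂ → R m q

namespace IsConvexRelation

open Relation

variable {V : Type*} [MetricSpace V] {A R : V → V → Prop}

theorem swap (hR : IsConvexRelation A R) :
    IsConvexRelation (Function.swap A) (Function.swap R) where
  orientation := hR.orientation.swap
  le _ _ h := reflTransGen_swap.2 (hR.le _ _ h)
  refl := hR.refl
  edge _ _ h := hR.edge _ _ h
  sub p q a b h h₁ h₂ h₃ := hR.sub q p b a h (reflTransGen_swap.1 h₃) (reflTransGen_swap.1 h₂)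
    (reflTransGen_swap.1 h₁)
  join p q₁ q₂ j h₁ h₂ h₃ h₄ := hR.meet q₁ q₂ p j h₁ h₂ (reflTransGen_swap.1 h₃)
    (reflTransGen_swap.1 h₄)
  meet p₁ p₂ q m h₁ h₂ h₃ h₄ := hR.join q p₁ p₂ m h₁ h₂ (reflTransGen_swap.1 h₃)
    (reflTransGen_swap.1 h₄)

variable {p q x y z s t g h : V}

/-- `z` is the join of its medians `z₁ ∈ [p, x]` and `z₂ ∈ [p, y]` with `p`, and `p ⊑ z₁`, `p ⊑ z₂`
by heredity. -/
theorem upper_convex [Finite V] (hR : IsConvexRelation A R) (hx : R p x) (hy : R p y) (hz : Between x z y) :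
    R p z := by
  have hA := hR.orientation
  have hpz := hA.le_of_between_of_le (hR.le _ _ hx) (hR.le _ _ hy) hz
  obtain ⟨z₁, h₁, h₁', h₁''⟩ := hA.modular.exists_median p z x
  obtain ⟨z₂, h₂, h₂', h₂''⟩ := hA.modular.exists_median p z y
  have a₁ := hA.le_and_le_of_between hpz h₁
  have a₂ := hA.le_and_le_of_between hpz h₂
  have b₁ := hA.le_and_le_of_between (hR.le _ _ hx) h₁''
  have b₂ := hA.le_and_le_of_between (hR.le _ _ hy) h₂''
  exact hR.join p z₁ z₂ z (hR.sub p x p z₁ hx .refl b₁.1 b₁.2)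
    (hR.sub p y p z₂ hy .refl b₂.1 b₂.2) a₁.2 a₂.2
    (h₂'.shrink_right (h₁'.symm.shrink_left hz))

theorem lower_convex [Finite V] (hR : IsConvexRelation A R) (hx : R x q) (hy : R y q) (hz : Between x z y) :
    R z q := hR.swap.upper_convex hx hy hz

/-- A related pair `(s, t)` can be moved in one coordinate towards a pair `(g, h)` of gates. -/
theorem exists_step [Finite V] (hR : IsConvexRelation A R) (hst : R s t) (hth : Between t h g)
    (hsg : Between s g h) (hne : ¬ (s = g ∧ t = h)) :
    ∃ s' t', R s' t' ∧ Between s s' g ∧ Between t t' h ∧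
      ((s' = s ∧ t' ≠ t) ∨ (s' ≠ s ∧ t' = t)) := by
  have hA := hR.orientation
  have hle := hR.le _ _ hst
  obtain ⟨m, hm₁, hm₂, hm₃⟩ := hA.modular.exists_median s t g
  by_cases hms : m = s
  swap
  · have := hA.le_and_le_of_between hle hm₁
    exact ⟨m, t, hR.sub s t m t hst this.1 this.2 .refl, hm₃, Between.left _ _, .inr ⟨hms, rfl⟩⟩
  subst hms
  obtain ⟨n, hn₁, hn₂, hn₃⟩ := hA.modular.exists_median m t h
  by_cases hnt : n = t
  swap
  · have := hA.le_and_le_of_between hle hn₁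
    exact ⟨m, n, hR.sub m t m n hst .refl this.1 this.2, Between.left _ _, hn₂,
      .inl ⟨rfl, hnt⟩⟩
  subst hnt
  -- Shrinking `[s, t]` from either end is now impossible, so `s, t, h, g` form a metric rectangle.
  clear hm₁ hm₃ hn₁ hn₂
  rename' m => s, n => t
  have e₁ : dist s g = dist t h := by
    unfold Between at *
    linarith [dist_comm s t, dist_comm g h]
  have e₂ : dist s t = dist g h := by
    unfold Between at *
    linarith [dist_comm s t, dist_comm g h]
  have hsg' : s ≠ g := by
    rintro rfl
    rw [dist_self] at e₁
    exact hne ⟨rfl, dist_le_zero.1 e₁.ge⟩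
  obtain ⟨a, hsa, ha⟩ := exists_adj_between hsg'
  obtain ⟨b, hb₁, hb₂, hb₃⟩ := hA.modular.exists_median a t h
  have hbt : b ≠ t := by
    rintro rfl
    have h₁ : Between b s a := ha.shrink_right hm₂
    have h₂ : Between a g h := ha.shrink_left hsg
    have := dist_pos.2 hsa.1
    unfold Between at *
    linarith [dist_comm s b, dist_comm a b, dist_comm g h]
  -- If `s → a`, convexity above `s` allows the upper end to move to `b`. If `a → s`, then `b ⪯ t`,
  -- so the first edge from `t` towards `b` is oriented `t₀ → t`, and convexity below `t` allows the
  -- lower end to move to `c`.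
  rcases (hA.adj_iff s a).1 hsa with has | has
  · exact ⟨s, b, hR.upper_convex (hR.edge _ _ has) hst hb₁, Between.left _ _, hb₂,
      .inl ⟨rfl, hbt⟩⟩
  have hbt' := (hA.le_and_le_of_between (hle.head has) hb₁).2
  obtain ⟨t₀, htt₀, ht₀⟩ := exists_adj_between hbt.symm
  have ht₀t := (hA.le_and_rel_of_adj hbt' t₀ htt₀.symm ht₀.symm).2
  obtain ⟨c, hc₁, hc₂, hc₃⟩ := hA.modular.exists_median t₀ s g
  refine ⟨c, t, hR.lower_convex (hR.edge _ _ ht₀t) hst hc₁, hc₂, Between.left _ _,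
    .inr ⟨?_, rfl⟩⟩
  rintro rfl
  have h₀ : Between t t₀ h := ht₀.extend_right hb₂
  have h₁ : Between c t t₀ := h₀.shrink_right hn₃
  have h₂ : Between t₀ h g := h₀.shrink_left hth
  have := dist_pos.2 htt₀.1
  unfold Between at *
  linarith [dist_comm c t₀, dist_comm g h]

theorem rel_of_gates [Finite V] (hR : IsConvexRelation A R) (hst : R s t) (hth : Between t h g)
    (hsg : Between s g h) : R g h := by
  suffices H : ∀ a : V × V, R a.1 a.2 → Between a.2 h g → Between a.1 g h → R g h from
    H (s, t) hst hth hsg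
  clear hst hth hsg
  intro a
  induction a using Finite.induction_of_real (fun a : V × V => dist a.1 g + dist a.2 h) with
  | h a ih =>
  obtain ⟨s, t⟩ := a
  intro hst hth hsg
  simp only at hst hth hsg ih
  by_cases hne : s = g ∧ t = h
  · exact hne.1 ▸ hne.2 ▸ hst
  obtain ⟨s', t', hst', hs', ht', hc⟩ := hR.exists_step hst hth hsg hne
  refine ih (s', t') ?_ hst' (ht'.shrink_left hth) (hs'.shrink_left hsg)
  rcases hc with ⟨rfl, hc⟩ | ⟨hc, rfl⟩
  · simpa using ht'.dist_lt_right hc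
  · simpa using hs'.dist_lt_right hc

/-! ### Mixed quadrangles -/

section mixed

variable {p₁ q₁ : V}

/-- The join `y` of `p` and `x` completes a rectangle on `p₁ → p`, so `x → y`. Then `p ⊑ y` and `x ⊑
y` give `p₁ ⊑ y` for the meet `p₁` of `p` and `x`, hence `p₁ ⊑ x`. Together with `p₁ ⊑ q` this
reaches `q₁` by convexity. -/
theorem rel_of_complement [Finite V] (hR : IsConvexRelation A R) (hp : A p₁ p) (hpq₁ : R p q₁)
    (hp₁q : R p₁ q) (hx₁ : ReflTransGen A p₁ x) (hx₂ : ReflTransGen A x q₁)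
    (hpx : Between p p₁ x) (hqx : Between q q₁ x) : R p₁ q₁ := by
  have hA := hR.orientation
  have hle := hR.le _ _ hpq₁
  obtain ⟨y, hy₁, hy₂, hy₃⟩ := hA.modular.exists_median p x q₁
  obtain ⟨hpy, hyq⟩ := hA.le_and_le_of_between hle hy₃
  obtain ⟨hxy, -⟩ := hA.le_and_le_of_between hx₂ hy₂
  have b₁ : Between p₁ x y := hA.between_of_le_of_le hx₁ hxy
  have b₂ : Between p₁ p y := hA.between_of_le_of_le (.single hp) hpy
  have hadj : (metricGraph V).Adj x y := by
    refine hA.modular.adj_of_rectangle (hA.adj hp) b₁ hy₁ ?_ ?_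
    · unfold Between at *
      linarith [dist_comm p p₁, dist_comm x y]
    · unfold Between at *
      linarith [dist_comm p p₁, dist_comm x y]
  have hxy' : A x y := by
    rcases (hA.adj_iff x y).1 hadj with h | h
    · exact h
    · exact absurd (hA.le_antisymm hxy (.single h)) hadj.1
  have h₁ : R p₁ y := hR.lower_convex (hR.sub p q₁ p y hpq₁ .refl hpy hyq) (hR.edge _ _ hxy') hpx
  exact hR.upper_convex hp₁q (hR.sub p₁ y p₁ x h₁ .refl hx₁ hxy) hqx

/-- The quadrangle condition for a change of the lower and a change of the upper end. -/
theorem rel_of_adj_of_adj [Finite V] (hR : IsConvexRelation A R) (hpq : R p q) (hst : R s t)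
    (hp₁q : R p₁ q) (hpq₁ : R p q₁) (hp : (metricGraph V).Adj p p₁)
    (hq : (metricGraph V).Adj q q₁) (hs : Between p p₁ s) (ht : Between q q₁ t) :
    R p₁ q₁ := by
  have hA := hR.orientation
  have hle := hR.le _ _ hpq
  have hle₁ := hR.le _ _ hpq₁
  have hle₂ := hR.le _ _ hp₁q
  rcases (hA.adj_iff _ _).1 hp with hp | hp <;> rcases (hA.adj_iff _ _).1 hq with hq | hq
  · exact hR.sub p q₁ p₁ q₁ hpq₁ (.single hp) (hle₂.tail hq) .refl
  -- Only `p₁ ⪯ q₁` is in question; it holds through the gates, `p₁ ⪯ g ⪯ h ⪯ q₁`.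
  · obtain ⟨g, hg₁, hg₂, hg⟩ := hA.exists_gate hle s
    obtain ⟨h, hh₁, hh₂, hh⟩ := hA.exists_gate hle t
    have hgh := hR.le _ _ (hR.rel_of_gates hst (hh g hg₁ hg₂) (hg h hh₁ hh₂))
    have h₁ : Between p p₁ g := (hg p₁ (.single hp) hle₂).symm.shrink_right hs
    have h₂ : Between q q₁ h := (hh q₁ hle₁ (.single hq)).symm.shrink_right ht
    have h₃ := (hA.le_and_le_of_between hg₁ h₁).2
    have h₄ := (hA.le_and_le_of_between hh₂ h₂.symm).1
    exact hR.sub p q p₁ q₁ hpq (.single hp) ((h₃.trans hgh).trans h₄) (.single hq)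
  · have hle₃ : ReflTransGen A p₁ q₁ := hle₂.tail hq
    obtain ⟨g, hg₁, hg₂, hg⟩ := hA.exists_gate hle₃ s
    obtain ⟨h, hh₁, hh₂, hh⟩ := hA.exists_gate hle₃ t
    have hgh := hR.rel_of_gates hst (hh g hg₁ hg₂) (hg h hh₁ hh₂)
    have h₁ : Between p p₁ g := (hg p₁ .refl hle₃).symm.shrink_right hs
    have h₂ : Between q q₁ h := (hh q₁ hle₃ .refl).symm.shrink_right ht
    -- If `q₁` is nearer to `g` than `q`, or `p₁` nearer to `h` than `p`, that gate is the `x` of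
    -- `rel_of_complement`. Otherwise `g ⊑ q` and `g ⊑ h` give `g ⊑ q₁`, and `p₁` lies between `p`
    -- and `g`.
    rcases hA.modular.between_or_between (hA.adj hq) g with hgq | hgq
    · have hgq' := (hA.le_and_le_of_between hg₂ hgq).1
      rcases hA.modular.between_or_between (hA.adj hp) h with hhp | hhp
      · exact hR.rel_of_complement hp hpq₁ hp₁q hh₁ hh₂ hhp.symm h₂
      · have hph := (hA.le_and_le_of_between hh₁ hhp.symm).2
        have h₃ : R g q₁ := hR.upper_convex (hR.sub p₁ q g q hp₁q hg₁ hgq' .refl) hgh h₂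
        exact hR.lower_convex hpq₁ h₃ h₁
    · exact hR.rel_of_complement hp hpq₁ hp₁q hg₁ hg₂ h₁ hgq.symm
  · exact hR.sub p₁ q p₁ q₁ hp₁q .refl (hle₁.head hp) (.single hq)

end mixed

/-! ### The metric on the related pairs -/

section pairs

variable {W : Type*} [MetricSpace W] {lo hi : W → V} {X Y Z : W}

theorem between_iff_of_sum (hd : ∀ X Y, dist X Y = dist (lo X) (lo Y) + dist (hi X) (hi Y)) :
    Between X Z Y ↔ Between (lo X) (lo Z) (lo Y) ∧ Between (hi X) (hi Z) (hi Y) := by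
  unfold Between
  rw [hd X Z, hd Z Y, hd X Y]
  constructor
  · intro h
    constructor <;>
    linarith [dist_triangle (lo X) (lo Z) (lo Y), dist_triangle (hi X) (hi Z) (hi Y)]
  · rintro ⟨h₁, h₂⟩
    linarith

theorem eq_of_sum (hd : ∀ X Y, dist X Y = dist (lo X) (lo Y) + dist (hi X) (hi Y))
    (h₁ : lo X = lo Y) (h₂ : hi X = hi Y) : X = Y := by
  refine dist_le_zero.1 ?_
  rw [hd, h₁, h₂, dist_self, dist_self, add_zero]

/-- If an edge `X Y` changed both ends, no related pair could lie strictly between. Medians in `[lo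
Y, hi Y]` then force the geodesics required by `exists_step`, which produces such a pair. -/
theorem pair_adj_iff [Finite V] (hR : IsConvexRelation A R)
    (hd : ∀ X Y, dist X Y = dist (lo X) (lo Y) + dist (hi X) (hi Y))
    (hW : ∀ X, R (lo X) (hi X)) (hex : ∀ p q, R p q → ∃ X, lo X = p ∧ hi X = q) :
    (metricGraph W).Adj X Y ↔
      (lo X = lo Y ∧ (metricGraph V).Adj (hi X) (hi Y)) ∨
      (hi X = hi Y ∧ (metricGraph V).Adj (lo X) (lo Y)) := by
  have hA := hR.orientation
  constructor
  · intro hXY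
    have key : ∀ s t, R s t → Between (lo X) s (lo Y) → Between (hi X) t (hi Y) →
        (s = lo X ∧ t = hi X) ∨ (s = lo Y ∧ t = hi Y) := by
      intro s t hst hs ht
      obtain ⟨Z, rfl, rfl⟩ := hex s t hst
      rcases eq_or_eq_of_adj hXY ((between_iff_of_sum hd).2 ⟨hs, ht⟩) with rfl | rfl
      · exact .inl ⟨rfl, rfl⟩
      · exact .inr ⟨rfl, rfl⟩
    by_cases hlo : lo X = lo Y
    · refine .inl ⟨hlo, metricGraph_adj_iff.2 ⟨fun h => hXY.1 (eq_of_sum hd hlo h), fun z hz => ?_⟩⟩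
      exact (key (lo X) z (hR.upper_convex (hW X) (hlo ▸ hW Y) hz) (Between.left _ _) hz).imp
        And.right And.right
    by_cases hhi : hi X = hi Y
    · refine .inr ⟨hhi, metricGraph_adj_iff.2 ⟨hlo, fun z hz => ?_⟩⟩
      exact (key z (hi X) (hR.lower_convex (hW X) (hhi ▸ hW Y) hz) hz (Between.left _ _)).imp
        And.left And.left
    exfalso
    have hle := hR.le _ _ (hW Y)
    have h₁ : Between (lo X) (lo Y) (hi Y) := by
      obtain ⟨m, hm₁, hm₂, hm₃⟩ := hA.modular.exists_median (lo Y) (hi Y) (lo X)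
      have := hA.le_and_le_of_between hle hm₁
      rcases key m (hi Y) (hR.sub _ _ _ _ (hW Y) this.1 this.2 .refl) hm₃.symm
        (Between.right _ _) with h | h
      · exact absurd h.2.symm hhi
      · exact h.1 ▸ hm₂.symm
    have h₂ : Between (hi X) (hi Y) (lo Y) := by
      obtain ⟨m, hm₁, hm₂, hm₃⟩ := hA.modular.exists_median (lo Y) (hi Y) (hi X)
      have := hA.le_and_le_of_between hle hm₁
      rcases key (lo Y) m (hR.sub _ _ _ _ (hW Y) .refl this.1 this.2) (Between.right _ _)
        hm₂.symm with h | h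
      · exact absurd h.1.symm hlo
      · exact h.2 ▸ hm₃.symm
    obtain ⟨s, t, hst, hs, ht, hc⟩ := hR.exists_step (hW X) h₂ h₁ fun h => hlo h.1
    rcases key s t hst hs ht with h | h
    · rcases hc with hc | hc
      · exact hc.2 h.2
      · exact hc.1 h.1
    · rcases hc with hc | hc
      · exact hlo (hc.1.symm.trans h.1)
      · exact hhi (hc.2.symm.trans h.2)
  · rintro (⟨h, hXY⟩ | ⟨h, hXY⟩)
    · refine metricGraph_adj_iff.2 ⟨fun he => hXY.1 (congrArg hi he), fun Z hZ => ?_⟩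
      obtain ⟨h₁, h₂⟩ := (between_iff_of_sum hd).1 hZ
      rw [← h] at h₁
      have h₁ := h₁.eq_of_self
      exact (eq_or_eq_of_adj hXY h₂).imp (eq_of_sum hd h₁) (eq_of_sum hd (h₁.trans h))
    · refine metricGraph_adj_iff.2 ⟨fun he => hXY.1 (congrArg lo he), fun Z hZ => ?_⟩
      obtain ⟨h₂, h₁⟩ := (between_iff_of_sum hd).1 hZ
      rw [← h] at h₁
      have h₁ := h₁.eq_of_self
      exact (eq_or_eq_of_adj hXY h₂).imp (eq_of_sum hd · h₁) (eq_of_sum hd · (h₁.trans h))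

theorem pair_isModularMetric [Finite V] [Finite W] (hR : IsConvexRelation A R)
    (hd : ∀ X Y, dist X Y = dist (lo X) (lo Y) + dist (hi X) (hi Y))
    (hW : ∀ X, R (lo X) (hi X)) (hex : ∀ p q, R p q → ∃ X, lo X = p ∧ hi X = q) :
    IsModularMetric W := by
  have hA := hR.orientation
  have hadj := fun X Y => hR.pair_adj_iff (X := X) (Y := Y) hd hW hex
  have hbtw := fun X Y Z => between_iff_of_sum (X := X) (Y := Y) (Z := Z) hd
  apply isModularMetric_of_quadrangle
  · intro X Y Z hXY
    rw [hbtw, hbtw]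
    rcases (hadj X Y).1 hXY with ⟨h, hXY⟩ | ⟨h, hXY⟩
    · rw [h]
      exact (hA.modular.between_or_between hXY (hi Z)).imp (⟨Between.right _ _, ·⟩)
        (⟨Between.right _ _, ·⟩)
    · rw [h]
      exact (hA.modular.between_or_between hXY (lo Z)).imp (⟨·, Between.right _ _⟩)
        (⟨·, Between.right _ _⟩)
  · intro X Y₁ Y₂ Z h₁ h₂ hne hz₁ hz₂
    rw [hbtw] at hz₁ hz₂
    simp only [hbtw]
    rcases (hadj _ _).1 h₁ with ⟨e₁, h₁⟩ | ⟨e₁, h₁⟩ <;>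
      rcases (hadj _ _).1 h₂ with ⟨e₂, h₂⟩ | ⟨e₂, h₂⟩
    · obtain ⟨m, hm₁, hm₂, hm₃⟩ := hA.modular.exists_median (hi Y₁) (hi Y₂) (hi Z)
      have hw₁ := hW Y₁
      have hw₂ := hW Y₂
      rw [← e₁] at hw₁
      rw [← e₂] at hw₂
      obtain ⟨M, hM, rfl⟩ := hex _ _ (hR.upper_convex hw₁ hw₂ hm₁)
      refine ⟨M, ?_⟩
      rw [hM, ← e₁, ← e₂]
      exact ⟨⟨Between.left _ _, hm₁⟩, ⟨Between.left _ _, hm₃⟩, ⟨Between.left _ _, hm₂⟩⟩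
    · have hw₁ := hW Y₁
      have hw₂ := hW Y₂
      rw [← e₁] at hw₁
      rw [← e₂] at hw₂
      obtain ⟨M, hM₁, hM₂⟩ := hex _ _
        (hR.rel_of_adj_of_adj (hW X) (hW Z) hw₂ hw₁ h₂ h₁ hz₂.1 hz₁.2)
      refine ⟨M, ?_⟩
      rw [hM₁, hM₂, ← e₁, ← e₂]
      exact ⟨⟨Between.right _ _, Between.left _ _⟩, ⟨hz₂.1, Between.left _ _⟩,
        ⟨Between.left _ _, hz₁.2⟩⟩
    · have hw₁ := hW Y₁
      have hw₂ := hW Y₂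
      rw [← e₁] at hw₁
      rw [← e₂] at hw₂
      obtain ⟨M, hM₁, hM₂⟩ := hex _ _
        (hR.rel_of_adj_of_adj (hW X) (hW Z) hw₁ hw₂ h₁ h₂ hz₁.1 hz₂.2)
      refine ⟨M, ?_⟩
      rw [hM₁, hM₂, ← e₁, ← e₂]
      exact ⟨⟨Between.left _ _, Between.right _ _⟩, ⟨Between.left _ _, hz₂.2⟩,
        ⟨hz₁.1, Between.left _ _⟩⟩
    · obtain ⟨m, hm₁, hm₂, hm₃⟩ := hA.modular.exists_median (lo Y₁) (lo Y₂) (lo Z)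
      have hw₁ := hW Y₁
      have hw₂ := hW Y₂
      rw [← e₁] at hw₁
      rw [← e₂] at hw₂
      obtain ⟨M, rfl, hM⟩ := hex _ _ (hR.lower_convex hw₁ hw₂ hm₁)
      refine ⟨M, ?_⟩
      rw [hM, ← e₁, ← e₂]
      exact ⟨⟨hm₁, Between.left _ _⟩, ⟨hm₃, Between.left _ _⟩, ⟨hm₂, Between.left _ _⟩⟩

end pairs

end IsConvexRelation

/-- The sum metric on a type of pairs. -/
abbrev sumMetric {V W : Type*} [MetricSpace V] (lo hi : W → V)
    (hinj : ∀ X Y, lo X = lo Y → hi X = hi Y → X = Y) : MetricSpace W where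
  dist X Y := dist (lo X) (lo Y) + dist (hi X) (hi Y)
  dist_self X := by simp
  dist_comm X Y := by rw [dist_comm (lo X), dist_comm (hi X)]
  dist_triangle X Y Z := by
    linarith [dist_triangle (lo X) (lo Y) (lo Z), dist_triangle (hi X) (hi Y) (hi Z)]
  eq_of_dist_eq_zero {X Y} h := by
    have h₁ := dist_nonneg (x := lo X) (y := lo Y)
    have h₂ := dist_nonneg (x := hi X) (y := hi Y)
    exact hinj X Y (dist_le_zero.1 (by linarith)) (dist_le_zero.1 (by linarith))

theorem IsConvexRelation.exists_pair_metric {V W : Type*} [MetricSpace V] [Finite V] [Finite W]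
    {A R : V → V → Prop} (hR : IsConvexRelation A R) {lo hi : W → V}
    (hinj : ∀ X Y, lo X = lo Y → hi X = hi Y → X = Y)
    (hW : ∀ X, R (lo X) (hi X)) (hex : ∀ p q, R p q → ∃ X, lo X = p ∧ hi X = q) :
    ∃ _ : MetricSpace W, IsModularMetric W ∧
      (∀ X Y, (metricGraph W).Adj X Y ↔ (lo X = lo Y ∧ (metricGraph V).Adj (hi X) (hi Y)) ∨
        (hi X = hi Y ∧ (metricGraph V).Adj (lo X) (lo Y))) ∧
      ∀ X Y : W, dist X Y = dist (lo X) (lo Y) + dist (hi X) (hi Y) := by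
  let _ : MetricSpace W := sumMetric lo hi hinj
  have hd : ∀ X Y : W, dist X Y = dist (lo X) (lo Y) + dist (hi X) (hi Y) := fun _ _ => rfl
  exact ⟨_, hR.pair_isModularMetric hd hW hex, fun _ _ => hR.pair_adj_iff hd hW hex, hd⟩

/-! ### Transfer to weighted digraphs -/

namespace WeightedDigraph

variable {V : Type*} {Γ : WeightedDigraph V} {R : V → V → Prop}

theorem underlying_adj {u v : V} : Γ.underlying.Adj u v ↔ u ≠ v ∧ (Γ.Adj u v ∨ Γ.Adj v u) := by
  simp [underlying, Digraph.toSimpleGraphInclusive]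

theorem IsModularComplex.underlying_adj (hΓ : Γ.IsModularComplex) {u v : V} :
    Γ.underlying.Adj u v ↔ Γ.Adj u v ∨ Γ.Adj v u := by
  rw [WeightedDigraph.underlying_adj, and_iff_right_iff_imp]
  rintro (h | h) rfl <;> exact hΓ.asymm _ _ h h

theorem IsModularComplex.isModularOrientation [MetricSpace V] (hΓ : Γ.IsModularComplex)
    (hV : IsModularMetric V) (hH : Γ.underlying = metricGraph V) :
    IsModularOrientation Γ.Adj where
  modular := hV
  asymm := hΓ.asymm
  adj_iff u v := by rw [← hH, hΓ.underlying_adj]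
  square := by
    rw [← hH]
    exact hΓ.admissible

theorem IsExtendedModularComplex.isConvexRelation [MetricSpace V]
    (hΓ : Γ.IsExtendedModularComplex R) (hV : IsModularMetric V)
    (hH : Γ.underlying = metricGraph V) : IsConvexRelation Γ.Adj R := by
  have := hΓ.complex.finite
  have hA := hΓ.complex.isModularOrientation hV hH
  refine ⟨hA, hΓ.rel.le, hΓ.rel.refl, hΓ.rel.edge, ?_, ?_, ?_⟩
  · exact fun p q a b h h₁ h₂ h₃ => hΓ.rel.sub p q a b h h₂ ⟨h₁, h₂.trans h₃⟩ ⟨h₁.trans h₂, h₃⟩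
  · exact fun p q₁ q₂ j h₁ h₂ h₃ h₄ hj => hΓ.rel.join p q₁ q₂ j h₁ h₂
      ⟨h₃, h₄, fun d hd₁ hd₂ => hA.le_of_between_of_upper_bound h₃ h₄ hj hd₁ hd₂⟩
  · exact fun p₁ p₂ q m h₁ h₂ h₃ h₄ hm => hΓ.rel.meet p₁ p₂ q m h₁ h₂
      ⟨h₃, h₄, fun d hd₁ hd₂ => Relation.reflTransGen_swap.1
        (hA.swap.le_of_between_of_upper_bound (Relation.reflTransGen_swap.2 h₃)
          (Relation.reflTransGen_swap.2 h₄) hm (Relation.reflTransGen_swap.2 hd₁)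
          (Relation.reflTransGen_swap.2 hd₂))⟩

theorem IsModularComplex.twoSubdivision_asymm (hΓ : Γ.IsModularComplex)
    (I J : SubdivisionVertex R) (h : (Γ.twoSubdivision R).Adj I J) :
    ¬ (Γ.twoSubdivision R).Adj J I := by
  have hirr : ∀ u, ¬ Γ.Adj u u := fun u h => hΓ.asymm _ _ h h
  rintro (⟨e', h'⟩ | ⟨e', h'⟩) <;> rcases h with ⟨e, h⟩ | ⟨e, h⟩
  · exact hΓ.asymm _ _ h h'
  · exact hirr _ (e' ▸ h)
  · exact hirr _ (e ▸ h')
  · exact hΓ.asymm _ _ h h'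

theorem IsModularComplex.twoSubdivision_underlying_adj (hΓ : Γ.IsModularComplex)
    (I J : SubdivisionVertex R) :
    (Γ.twoSubdivision R).underlying.Adj I J ↔
      (I.1.1 = J.1.1 ∧ Γ.underlying.Adj I.1.2 J.1.2) ∨
      (I.1.2 = J.1.2 ∧ Γ.underlying.Adj I.1.1 J.1.1) := by
  rw [WeightedDigraph.underlying_adj, hΓ.underlying_adj, hΓ.underlying_adj]
  have hne : (Γ.twoSubdivision R).Adj I J ∨ (Γ.twoSubdivision R).Adj J I → I ≠ J := by
    rintro (h | h) rfl <;> exact hΓ.twoSubdivision_asymm _ _ h h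
  rw [and_iff_right_of_imp hne]
  simp only [twoSubdivision, eq_comm (a := J.1.1), eq_comm (a := J.1.2)]
  tauto

/-- A 4-cycle of `Γ*` either moves one endpoint throughout, and comes from a 4-cycle of `Γ`
(reversed for lower ends), or alternates, and its opposite edges carry the same edge of `Γ`. -/
theorem IsModularComplex.twoSubdivision_isAdmissibleOrientation (hΓ : Γ.IsModularComplex) :
    (Γ.twoSubdivision R).IsAdmissibleOrientation := by
  have hirr : ∀ u, ¬ Γ.Adj u u := fun u h => hΓ.asymm _ _ h h
  rintro ⟨⟨p₁, q₁⟩, r₁⟩ ⟨⟨p₂, q₂⟩, r₂⟩ ⟨⟨p₃, q₃⟩, r₃⟩ ⟨⟨p₄, q₄⟩, r₄⟩ h₁₃ h₂₄ h₁₂ h₂₃ h₃₄ h₄₁ h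
  rw [hΓ.twoSubdivision_underlying_adj] at h₁₂ h₂₃ h₃₄ h₄₁
  simp only [ne_eq, Subtype.mk.injEq, Prod.mk.injEq, twoSubdivision] at *
  have hirr' : ∀ u, ¬ Γ.underlying.Adj u u := fun u h => h.ne rfl
  have hsq := hΓ.admissible
  rcases h with ⟨rfl, h⟩ | ⟨rfl, h⟩
  · rcases h₂₃ with ⟨rfl, h₂₃⟩ | ⟨rfl, h₂₃⟩
    · rcases h₃₄ with ⟨rfl, h₃₄⟩ | ⟨rfl, h₃₄⟩
      · left
        simp only [true_and] at *
        refine hsq q₁ q₂ q₃ q₄ h₁₃ h₂₄ (hΓ.underlying_adj.2 (.inl h)) h₂₃ h₃₄ ?_ h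
        simpa [hirr'] using h₄₁
      · grind
    · rcases h₃₄ with ⟨rfl, h₃₄⟩ | ⟨rfl, h₃₄⟩ <;> grind
  · rcases h₂₃ with ⟨rfl, h₂₃⟩ | ⟨rfl, h₂₃⟩
    · rcases h₃₄ with ⟨rfl, h₃₄⟩ | ⟨rfl, h₃₄⟩ <;> grind
    · rcases h₃₄ with ⟨rfl, h₃₄⟩ | ⟨rfl, h₃₄⟩
      · grind
      · right
        simp only [and_true, true_and] at *
        refine hsq p₂ p₁ p₄ p₃ h₂₄ h₁₃ (hΓ.underlying_adj.2 (.inl h)) ?_ h₃₄.symm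
          h₂₃.symm h
        simpa [hirr', SimpleGraph.adj_comm] using h₄₁

theorem IsExtendedModularComplex.twoSubdivision_isModular (hΓ : Γ.IsExtendedModularComplex R) :
    (Γ.twoSubdivision R).IsModular := by
  have := hΓ.complex.finite
  obtain ⟨_, hV, hH, hw⟩ := hΓ.complex.modular
  have hR := hΓ.isConvexRelation hV hH
  obtain ⟨m, hm, hadj, hd⟩ := hR.exists_pair_metric (W := SubdivisionVertex R)
    (lo := fun I => I.1.1) (hi := fun I => I.1.2)
    (fun _ _ h₁ h₂ => Subtype.ext (Prod.ext h₁ h₂)) (fun I => I.2)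
    (fun p q h => ⟨⟨(p, q), h⟩, rfl, rfl⟩)
  refine ⟨m, hm, ?_, ?_⟩
  · ext I J
    rw [hΓ.complex.twoSubdivision_underlying_adj, hH]
    exact (hadj I J).symm
  · rintro I J (⟨e, h⟩ | ⟨e, h⟩)
    · refine Eq.trans ?_ (hd I J).symm
      rw [e, dist_self, zero_add, ← hw _ _ h]
      simp [twoSubdivision, e]
    -- Distinct lower ends select the second branch of `wt`.
    · have hne : I.1.1 ≠ J.1.1 := fun he => hΓ.complex.asymm _ _ (he ▸ h) (he ▸ h)
      refine Eq.trans ?_ (hd I J).symm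
      rw [e, dist_self, add_zero, dist_comm, ← hw _ _ h]
      simp [twoSubdivision, hne]

theorem IsExtendedModularComplex.interval_injective (hΓ : Γ.IsExtendedModularComplex R) :
    Function.Injective (fun I : SubdivisionVertex R => Γ.interval I.1.1 I.1.2) := by
  obtain ⟨_, hV, hH, -⟩ := hΓ.complex.modular
  have hA := hΓ.complex.isModularOrientation hV hH
  intro I J h
  have hI := hΓ.rel.le _ _ I.2
  have hJ := hΓ.rel.le _ _ J.2
  have hmem : ∀ x, x ∈ Γ.interval I.1.1 I.1.2 ↔ x ∈ Γ.interval J.1.1 J.1.2 := fun x => by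
    simp only at h
    rw [h]
  have h₁ := (hmem I.1.1).1 ⟨.refl, hI⟩
  have h₂ := (hmem I.1.2).1 ⟨hI, .refl⟩
  have h₃ := (hmem J.1.1).2 ⟨.refl, hJ⟩
  have h₄ := (hmem J.1.2).2 ⟨hJ, .refl⟩
  exact Subtype.ext (Prod.ext (hA.le_antisymm h₃.1 h₁.1) (hA.le_antisymm h₂.2 h₄.2))

end WeightedDigraph

theorem theorem1 {V : Type*} (Γ : WeightedDigraph V) (R : V → V → Prop)
    (hΓ : Γ.IsExtendedModularComplex R) :
    Function.Injective (fun I : WeightedDigraph.SubdivisionVertex R => Γ.interval I.1.1 I.1.2) ∧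
      (Γ.twoSubdivision R).IsModularComplex := by
  have := hΓ.complex.finite
  exact ⟨hΓ.interval_injective, inferInstance, hΓ.complex.twoSubdivision_asymm,
    hΓ.twoSubdivision_isModular, hΓ.complex.twoSubdivision_isAdmissibleOrientation⟩
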